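/- Let $B,U,L,W$ be integers with $B\ge 1$, $1\le L\le W$, let $\sigma\ge 0$ and let $\delta\in[-1,1]$ be such that the matrix $\mathbf R=(1-\delta)\mathbf I_B+\delta\mathbf 1_B\in\mathbb C^{B\times B}$ (ones on the diagonal, $\delta$ off the diagonal) is positive semidefinite, with positive semidefinite square root $\mathbf R^{1/2}$. Let $\widetilde{\mathbf H}_\ell\in\mathbb C^{B\times U}$, $\ell=0,\dots,L-1$, and $\mathbf E_\omega\in\mathbb C^{B\times U}$, $\omega=0,\dots,W-1$, be random matrices all of whose entries are jointly independent, where the entries of the $\widetilde{\mathbf H}_\ell$ have the circularly-symmetric complex Gaussian distribution $\mathcal{CN}(0,1/(BL))$ and the entries of the $\mathbf E_\omega$ the distribution $\mathcal{CN}(0,1)$. Define, for $\omega=0,\dots,W-1$, $$\mathbf H_\omega=\sum_{\ell=0}^{L-1}\mathbf R^{1/2}\,\widetilde{\mathbf H}_\ell\, e^{-j2\pi\omega\ell/W}+\sigma\,\mathbf E_\omega,\qquad \mathbf G_\omega=\mathbf H_\omega^H\mathbf H_\omega .$$ Let $\mathcal P\subseteq\Omega\subseteq\{0,\dots,W-1\}$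 be sets of base points and of active subcarriers. For every target subcarrier $\omega\in\Omega\setminus\mathcal P$ let $p=p(\omega)\in\mathcal P$ be a base point minimizing $|\tilde p-\omega|$ over $\tilde p\in\mathcal P$ (ties broken arbitrarily), and let $\widetilde{\mathbf G}_\omega=\mathbf G_{p}$ be the 0th order (nearest-neighbor) interpolated Gram matrix. Then for every $\omega\in\Omega\setminus\mathcal P$ and every entry $(m,n)$, $1\le m,n\le U$, the mean-squared error is finite and $$\mathbb E\Big[\big|[\widetilde{\mathbf G}_\omega]_{m,n}-[\mathbf G_\omega]_{m,n}\big|^2\Big]=\varepsilon_{\mathrm{CSI}}+\frac{2}{B}\,(1+\varepsilon_{\mathrm{cor}})\left(1-f_L\!\Big(\frac{2\pi}{W}(p-\omega)\Big)\right),$$ where $\varepsilon_{\mathrm{CSI}}=2\sigma^2(2+B\sigma^2)$, $\varepsilon_{\mathrm{cor}}=\delta^2(B-1)$, and $f_L(\phi)=L^{-2}\,\dfrac{1-\cos(L\phi)}{1-\cos\phi}$ is the scaled Fejér kernel. -/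

import Mathlib

open MeasureTheory ProbabilityTheory
open scoped NNReal Matrix MatrixOrder ComplexOrder

noncomputable section

/-- The circularly-symmetric complex Gaussian distribution `CN(0, v)`: the law of `x + j y` with
`x` and `y` independent, each real Gaussian with mean `0` and variance `v / 2`. -/
def complexGaussian (v : ℝ≥0) : Measure ℂ :=
  ((gaussianReal 0 (v / 2)).prod (gaussianReal 0 (v / 2))).map
    (fun z : ℝ × ℝ => (z.1 : ℂ) + (z.2 : ℂ) * Complex.I)

/-- The scaled Fejér kernel `f_L(φ) = L⁻² (1 - cos (L φ)) / (1 - cos φ)`, for `φ ∉ 2πℤ`. -/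
def scaledFejer (L : ℕ) (φ : ℝ) : ℝ :=
  ((L : ℝ) ^ 2)⁻¹ * ((1 - Real.cos (L * φ)) / (1 - Real.cos φ))

/-- The receive correlation matrix `R = (1 - δ) I + δ 𝟏`, with ones on the diagonal and `δ` off
the diagonal. -/
def corrMatrix (B : ℕ) (δ : ℝ) : Matrix (Fin B) (Fin B) ℂ :=
  Matrix.of fun i j => if i = j then 1 else (δ : ℂ)

/-- The correlated time-domain tap `R^{1/2} H`, where `R^{1/2}` is the positive semidefinite
square root. -/
def correlatedTap {B U : ℕ} (δ : ℝ) (H : Matrix (Fin B) (Fin U) ℂ) : Matrix (Fin B) (Fin U) ℂ :=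
  CFC.sqrt (corrMatrix B δ) * H

/-- The frequency-domain channel matrix on subcarrier `ω`,
`H_ω = ∑_{ℓ < L} R^{1/2} H_ℓ exp (-j 2π ω ℓ / W) + σ E_ω`, built from the uncorrelated taps `H_ℓ`
and the estimation error matrices `E_ω`. -/
def freqChannel {B U L W : ℕ} (δ σ : ℝ) (H : Fin L → Matrix (Fin B) (Fin U) ℂ)
    (E : Fin W → Matrix (Fin B) (Fin U) ℂ) (ω : Fin W) : Matrix (Fin B) (Fin U) ℂ :=
  (∑ l : Fin L,
    Complex.exp (-(Complex.I * 2 * Real.pi * ((ω : ℕ) : ℂ) * ((l : ℕ) : ℂ) / (W : ℂ))) •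
      correlatedTap δ (H l)) + (σ : ℂ) • E ω

/-- The Gram matrix `G_ω = H_ωᴴ H_ω` on subcarrier `ω`. -/
def gramMatrix {B U L W : ℕ} (δ σ : ℝ) (H : Fin L → Matrix (Fin B) (Fin U) ℂ)
    (E : Fin W → Matrix (Fin B) (Fin U) ℂ) (ω : Fin W) : Matrix (Fin U) (Fin U) ℂ :=
  (freqChannel δ σ H E ω)ᴴ * freqChannel δ σ H E ω

/-- `p` is a base point in `P` of minimal distance to the subcarrier `ω`. -/
def IsNearestBasePoint {W : ℕ} (P : Finset (Fin W)) (ω p : Fin W) : Prop :=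
  p ∈ P ∧ ∀ q ∈ P, |((p : ℕ) : ℤ) - ((ω : ℕ) : ℤ)| ≤ |((q : ℕ) : ℤ) - ((ω : ℕ) : ℤ)|

/-- The Gram matrix used on subcarrier `ω` by 0th order interpolation: the exact one on the base
points, and the one of the selected base point `nearest ω` on the other subcarriers. -/
def zeroOrderInterp {U W : ℕ} (P : Finset (Fin W)) (nearest : Fin W → Fin W)
    (G : Fin W → Matrix (Fin U) (Fin U) ℂ) (ω : Fin W) : Matrix (Fin U) (Fin U) ℂ :=
  if ω ∈ P then G ω else G (nearest ω)

/-- The squared error of 0th order interpolation on the entry `(m, n)` at subcarrier `ω`. -/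
def zeroOrderSqError {B U L W : ℕ} (δ σ : ℝ) (P : Finset (Fin W)) (nearest : Fin W → Fin W)
    (H : Fin L → Matrix (Fin B) (Fin U) ℂ) (E : Fin W → Matrix (Fin B) (Fin U) ℂ)
    (ω : Fin W) (m n : Fin U) : ℝ :=
  ‖zeroOrderInterp P nearest (gramMatrix δ σ H E) ω m n - gramMatrix δ σ H E ω m n‖ ^ 2

/-- `ε_CSI = 2 σ² (2 + B σ²)`. -/
def epsCSI (B : ℕ) (σ : ℝ) : ℝ := 2 * σ ^ 2 * (2 + (B : ℝ) * σ ^ 2)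

/-- `ε_cor = δ² (B - 1)`. -/
def epsCor (B : ℕ) (δ : ℝ) : ℝ := δ ^ 2 * ((B : ℝ) - 1)

end

/-! Expand `|G_p - G_ω|²` into four products `G_q * star G_q'`. Channel entries are linear
combinations of independent circular Gaussians, so Wick's formula (`integral_wick_sum`) gives each
expectation as a sum over two pairings of covariances. The pairing inside each Gram entry
contributes only for `m = n`. It is a product of two traces that do not depend on the subcarrier, so
it cancels from the difference. The pairing across the two Gram entries leaves a double sum over
antennas. For equal subcarriers it is `(1 + ε_cor)/B + 2σ² + Bσ⁴`. For distinct ones the noise is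
uncorrelated and the rest is damped to `(1 + ε_cor)/B · |ρ|²`, where `ρ` is the average of the tap
phases `exp(-jφl)`. As a geometric sum, it satisfies `|ρ|² = f_L(φ)`. Twice the gap between the two
values is the claim. -/

/-! ### Moments of real Gaussians. -/

theorem integrable_pow_gaussianReal (v : ℝ≥0) (n : ℕ) :
    Integrable (fun x : ℝ => x ^ n) (gaussianReal 0 v) := by
  rcases Nat.eq_zero_or_pos n with rfl | hn
  · simp
  · have h := (memLp_id_gaussianReal (μ := 0) (v := v) n).integrable_norm_pow hn.ne'
    refine (integrable_norm_iff (by fun_prop)).1 ?_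
    simpa using h

theorem integral_sq_gaussianReal (v : ℝ≥0) : ∫ x : ℝ, x ^ 2 ∂gaussianReal 0 v = v := by
  have h := variance_fun_id_gaussianReal (μ := 0) (v := v)
  rw [variance_of_integral_eq_zero (by fun_prop) (by simp)] at h
  exact h

theorem integral_pow_four_gaussianReal (v : ℝ≥0) :
    ∫ x : ℝ, x ^ 4 ∂gaussianReal 0 v = 3 * (v : ℝ) ^ 2 := by
  have h := iteratedDeriv_mgf_zero (X := id) (μ := gaussianReal 0 v) (by simp) 4
  simp only [Pi.pow_apply, id] at h
  rw [← h, mgf_id_gaussianReal]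
  have h0 (t : ℝ) : HasDerivAt (fun t : ℝ => Real.exp (0 * t + v * t ^ 2 / 2))
      (Real.exp (0 * t + v * t ^ 2 / 2) * (v * t)) t := by
    refine HasDerivAt.exp ?_
    have := (((hasDerivAt_id t).const_mul 0).add
      (((hasDerivAt_pow 2 t).const_mul (v : ℝ)).div_const 2))
    convert! this using 1
    simp; ring
  -- Every derivative of the mgf is the exponential times a polynomial, and differentiation acts on
  -- that polynomial by `p ↦ v t p + p'`.
  have hp (p : ℝ → ℝ) (p' : ℝ) (t : ℝ) (hp : HasDerivAt p p' t) :
      HasDerivAt (fun t : ℝ => Real.exp (0 * t + v * t ^ 2 / 2) * p t)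
      (Real.exp (0 * t + v * t ^ 2 / 2) * (v * t * p t + p')) t := by
    convert! (h0 t).mul hp using 1
    ring
  have d1 : deriv (fun t : ℝ => Real.exp (0 * t + v * t ^ 2 / 2)) =
      fun t => Real.exp (0 * t + v * t ^ 2 / 2) * (v * t) := funext fun t => (h0 t).deriv
  have d2 : deriv (fun t : ℝ => Real.exp (0 * t + v * t ^ 2 / 2) * (v * t)) =
      fun t => Real.exp (0 * t + v * t ^ 2 / 2) * (v * t * (v * t) + v) := funext fun t => by
    refine (hp _ _ t ?_).deriv
    simpa using (hasDerivAt_id t).const_mul (v : ℝ)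
  have d3 : deriv (fun t : ℝ => Real.exp (0 * t + v * t ^ 2 / 2) * (v * t * (v * t) + v)) =
      fun t => Real.exp (0 * t + v * t ^ 2 / 2) *
        (v * t * (v * t * (v * t) + v) + 2 * v ^ 2 * t) := funext fun t => by
    refine (hp _ _ t ?_).deriv
    have h1 : HasDerivAt (fun t : ℝ => v * t) v t := by
      simpa using (hasDerivAt_id t).const_mul (v : ℝ)
    convert! (h1.mul h1).add_const (v : ℝ) using 1
    ring
  have d4 : deriv (fun t : ℝ => Real.exp (0 * t + v * t ^ 2 / 2) *
        (v * t * (v * t * (v * t) + v) + 2 * v ^ 2 * t)) 0 = 3 * (v : ℝ) ^ 2 := by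
    have h1 : HasDerivAt (fun t : ℝ => v * t) v 0 := by
      simpa using (hasDerivAt_id (0 : ℝ)).const_mul (v : ℝ)
    have h2 : HasDerivAt (fun t : ℝ => 2 * (v : ℝ) ^ 2 * t) (2 * (v : ℝ) ^ 2) 0 := by
      simpa using (hasDerivAt_id (0 : ℝ)).const_mul (2 * (v : ℝ) ^ 2)
    refine (hp _ _ 0 ((h1.mul ((h1.mul h1).add_const (v : ℝ))).add h2)).deriv.trans ?_
    simp; ring
  simp only [iteratedDeriv_succ, iteratedDeriv_zero, d1, d2, d3, d4]

/-! ### Moments of circular complex Gaussians. -/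

instance isProbabilityMeasure_complexGaussian (v : ℝ≥0) :
    IsProbabilityMeasure (complexGaussian v) :=
  Measure.isProbabilityMeasure_map (by fun_prop)

theorem memLp_id_complexGaussian (v p : ℝ≥0) :
    MemLp (fun z : ℂ => z) p (complexGaussian v) := by
  rw [complexGaussian, memLp_map_measure_iff (by fun_prop) (by fun_prop)]
  have h := memLp_id_gaussianReal (μ := 0) (v := v / 2) p
  have h1 := (h.comp_fst (gaussianReal 0 (v / 2))).ofReal (K := ℂ)
  have h2 := ((h.comp_snd (gaussianReal 0 (v / 2))).ofReal (K := ℂ)).mul_const Complex.I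
  exact h1.add h2

theorem integral_complexGaussian (v : ℝ≥0) (f : ℂ → ℂ) (hf : Continuous f) :
    ∫ z, f z ∂complexGaussian v = ∫ z : ℝ × ℝ, f ((z.1 : ℂ) + (z.2 : ℂ) * Complex.I)
      ∂((gaussianReal 0 (v / 2)).prod (gaussianReal 0 (v / 2))) := by
  rw [complexGaussian, integral_map (by fun_prop) (by fun_prop)]

theorem integrable_monomial_prod_gaussianReal (v : ℝ≥0) (a b : ℕ) :
    Integrable (fun z : ℝ × ℝ => (z.1 : ℂ) ^ a * (z.2 : ℂ) ^ b)
      ((gaussianReal 0 v).prod (gaussianReal 0 v)) := by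
  have h := ((integrable_pow_gaussianReal v a).mul_prod (integrable_pow_gaussianReal v b)).ofReal
    (𝕜 := ℂ)
  simpa using h

theorem integral_monomial_prod_gaussianReal (v : ℝ≥0) (a b : ℕ) :
    ∫ z : ℝ × ℝ, (z.1 : ℂ) ^ a * (z.2 : ℂ) ^ b
      ∂((gaussianReal 0 v).prod (gaussianReal 0 v)) =
    ((∫ x : ℝ, x ^ a ∂gaussianReal 0 v : ℝ) : ℂ) * ((∫ x : ℝ, x ^ b ∂gaussianReal 0 v : ℝ) : ℂ) := by
  rw [← Complex.ofReal_mul, ← integral_prod_mul]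
  refine Eq.trans ?_ integral_ofReal
  simp

theorem integral_id_complexGaussian (v : ℝ≥0) : ∫ z, z ∂complexGaussian v = 0 := by
  rw [integral_complexGaussian v (fun z => z) continuous_id]
  have i1 := integrable_monomial_prod_gaussianReal (v / 2) 1 0
  have i2 := (integrable_monomial_prod_gaussianReal (v / 2) 0 1).mul_const Complex.I
  have e : ∀ z : ℝ × ℝ, (z.1 : ℂ) + (z.2 : ℂ) * Complex.I =
    (z.1 : ℂ) ^ 1 * (z.2 : ℂ) ^ 0 + (z.1 : ℂ) ^ 0 * (z.2 : ℂ) ^ 1 * Complex.I := fun z => by ring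
  simp_rw [e]
  rw [integral_add i1 i2, integral_mul_const, integral_monomial_prod_gaussianReal,
    integral_monomial_prod_gaussianReal]
  simp

/-- Circularity: real and imaginary parts have equal variance and zero correlation. Hence Wick
pairings of two unconjugated factors vanish. -/
theorem integral_sq_complexGaussian (v : ℝ≥0) : ∫ z, z ^ 2 ∂complexGaussian v = 0 := by
  rw [integral_complexGaussian v (fun z => z ^ 2) (by fun_prop)]
  have i1 := integrable_monomial_prod_gaussianReal (v / 2) 2 0
  have i2 := integrable_monomial_prod_gaussianReal (v / 2) 0 2
  have i3 := (integrable_monomial_prod_gaussianReal (v / 2) 1 1).mul_const (2 * Complex.I)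
  have e : ∀ z : ℝ × ℝ, ((z.1 : ℂ) + (z.2 : ℂ) * Complex.I) ^ 2 =
    (z.1 : ℂ) ^ 2 * (z.2 : ℂ) ^ 0 - (z.1 : ℂ) ^ 0 * (z.2 : ℂ) ^ 2
      + (z.1 : ℂ) ^ 1 * (z.2 : ℂ) ^ 1 * (2 * Complex.I) := fun z => by
    linear_combination (z.2 : ℂ) ^ 2 * Complex.I_sq
  simp_rw [e]
  refine (integral_add (i1.sub i2) i3).trans ?_
  simp only [Pi.sub_apply]
  rw [integral_sub i1 i2, integral_mul_const]
  simp only [integral_monomial_prod_gaussianReal]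
  simp

theorem integral_conj_mul_self_complexGaussian (v : ℝ≥0) :
    ∫ z, star z * z ∂complexGaussian v = v := by
  rw [integral_complexGaussian v (fun z => star z * z) (by fun_prop)]
  have i1 := integrable_monomial_prod_gaussianReal (v / 2) 2 0
  have i2 := integrable_monomial_prod_gaussianReal (v / 2) 0 2
  have e : ∀ z : ℝ × ℝ, star ((z.1 : ℂ) + (z.2 : ℂ) * Complex.I) *
      ((z.1 : ℂ) + (z.2 : ℂ) * Complex.I) =
    (z.1 : ℂ) ^ 2 * (z.2 : ℂ) ^ 0 + (z.1 : ℂ) ^ 0 * (z.2 : ℂ) ^ 2 := fun z => by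
    simp only [Complex.star_def, map_add, map_mul, Complex.conj_ofReal, Complex.conj_I]
    linear_combination -(z.2 : ℂ) ^ 2 * Complex.I_sq
  simp_rw [e]
  rw [integral_add i1 i2]
  simp only [integral_monomial_prod_gaussianReal, integral_sq_gaussianReal]
  simp

/-- From `(x² + y²)²` one gets `2 · 3(v/2)² + 2(v/2)²`. The factor 2 counts the two pairings that
coincide when all four Wick indices agree. -/
theorem integral_conj_mul_self_sq_complexGaussian (v : ℝ≥0) :
    ∫ z, (star z * z) ^ 2 ∂complexGaussian v = 2 * (v : ℂ) ^ 2 := by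
  rw [integral_complexGaussian v (fun z => (star z * z) ^ 2) (by fun_prop)]
  have i1 := integrable_monomial_prod_gaussianReal (v / 2) 4 0
  have i2 := integrable_monomial_prod_gaussianReal (v / 2) 0 4
  have i3 := (integrable_monomial_prod_gaussianReal (v / 2) 2 2).mul_const 2
  have e : ∀ z : ℝ × ℝ, (star ((z.1 : ℂ) + (z.2 : ℂ) * Complex.I) *
      ((z.1 : ℂ) + (z.2 : ℂ) * Complex.I)) ^ 2 =
    (z.1 : ℂ) ^ 4 * (z.2 : ℂ) ^ 0 + (z.1 : ℂ) ^ 0 * (z.2 : ℂ) ^ 4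
      + (z.1 : ℂ) ^ 2 * (z.2 : ℂ) ^ 2 * 2 := fun z => by
    have : star ((z.1 : ℂ) + (z.2 : ℂ) * Complex.I) * ((z.1 : ℂ) + (z.2 : ℂ) * Complex.I) =
        (z.1 : ℂ) ^ 2 + (z.2 : ℂ) ^ 2 := by
      simp only [Complex.star_def, map_add, map_mul, Complex.conj_ofReal, Complex.conj_I]
      linear_combination -(z.2 : ℂ) ^ 2 * Complex.I_sq
    rw [this]; ring
  simp_rw [e]
  refine (integral_add (i1.add i2) i3).trans ?_
  simp only [Pi.add_apply]
  rw [integral_add i1 i2, integral_mul_const]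
  simp only [integral_monomial_prod_gaussianReal, integral_sq_gaussianReal,
    integral_pow_four_gaussianReal]
  simp; ring

/-! ### Fourth-order Wick formula. -/

section Wick

variable {S : Type*} [MeasurableSpace S] {μ : Measure S} {ι : Type*}

theorem memLp_of_hasLaw_complexGaussian {X : S → ℂ} {v : ℝ≥0}
    (hX : HasLaw X (complexGaussian v) μ) (p : ℝ≥0) : MemLp X p μ := by
  have h := memLp_id_complexGaussian v p
  rw [← hX.map_eq] at h
  exact h.comp_of_map hX.aemeasurable

/-- Hölder twice: products of two `L⁴` functions are in `L²`, and products of two of those are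
integrable. -/
theorem integrable_conj_mul_mul_mul_conj {f g h k : S → ℂ} (hf : MemLp f 4 μ) (hg : MemLp g 4 μ)
    (hh : MemLp h 4 μ) (hk : MemLp k 4 μ) :
    Integrable (fun s => star (f s) * g s * (h s * star (k s))) μ := by
  have : ENNReal.HolderTriple 4 4 2 := ⟨by
    rw [← two_mul, show (4 : ENNReal) = 2 * 2 by norm_num,
      ENNReal.mul_inv (by simp) (by simp), ← mul_assoc, ENNReal.mul_inv_cancel (by simp) (by simp),
      one_mul]⟩
  have h1 : MemLp (fun s => star (f s) * g s) 2 μ := hg.mul hf.star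
  have h2 : MemLp (fun s => h s * star (k s)) 2 μ := hk.star.mul hh
  exact h1.integrable_mul h2

variable [Fintype ι] {X : ι → S → ℂ} {v : ι → ℝ≥0}

theorem memLp_sum_of_hasLaw_complexGaussian (hX : ∀ i, HasLaw (X i) (complexGaussian (v i)) μ)
    (c : ι → ℂ) : MemLp (fun s => ∑ i, c i * X i s) 4 μ :=
  memLp_finsetSum _ fun i _ => (memLp_of_hasLaw_complexGaussian (hX i) 4).const_mul (c i)

/-- The Hermitian form `∑ i, cᵢ conj dᵢ vᵢ`: the covariance of the linear combinations with
coefficients `c` and `d` of independent variables of variances `vᵢ`. -/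
def weightedInner (v : ι → ℝ≥0) (c d : ι → ℂ) : ℂ := ∑ i, c i * star (d i) * v i

variable [DecidableEq ι]

/-- Wick's formula for the fourth order moments of independent circularly-symmetric complex
Gaussian variables. -/
theorem integral_wick_of_iIndepFun
    (hX : ∀ i, HasLaw (X i) (complexGaussian (v i)) μ) (hind : iIndepFun X μ) (i j k l : ι) :
    ∫ s, star (X i s) * X j s * (X k s * star (X l s)) ∂μ =
      (if i = j ∧ k = l then (v i : ℂ) * v k else 0) +
        (if i = k ∧ j = l then (v i : ℂ) * v j else 0) := by
  -- `g t` collects the factors that involve the variable `X t`, so that independence turns the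
  -- expectation into a product over `t`.
  set g : ι → ℂ → ℂ := fun t z => (if t = i then star z else 1) * (if t = j then z else 1) *
    ((if t = k then z else 1) * (if t = l then star z else 1)) with hg
  have hgc (t : ι) : Continuous (g t) := by
    simp only [hg]
    split_ifs <;> fun_prop
  have e1 : ∀ s, star (X i s) * X j s * (X k s * star (X l s)) = ∏ t, g t (X t s) := fun s => by
    simp only [hg, Finset.prod_mul_distrib, Finset.prod_ite_eq', Finset.mem_univ, if_true]
  have e2 : ∫ s, star (X i s) * X j s * (X k s * star (X l s)) ∂μ =
      ∏ t, ∫ z, g t z ∂complexGaussian (v t) := by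
    simp_rw [e1]
    rw [hind.integral_fun_prod_comp (fun i => (hX i).aemeasurable)
      (fun i => (hgc i).aestronglyMeasurable)]
    refine Finset.prod_congr rfl fun t _ => ?_
    exact (hX t).integral_comp (hgc t).aestronglyMeasurable
  have hstar (w : ℝ≥0) : ∫ z, star z ∂complexGaussian w = 0 := by
    have := integral_conj (μ := complexGaussian w) (f := fun z : ℂ => z)
    rw [integral_id_complexGaussian] at this
    simpa using this
  have hstar2 (w : ℝ≥0) : ∫ z, star z * star z ∂complexGaussian w = 0 := by
    have := integral_conj (μ := complexGaussian w) (f := fun z : ℂ => z ^ 2)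
    rw [integral_sq_complexGaussian] at this
    simpa [sq] using this
  have h4 (w : ℝ≥0) : ∫ z, star z * z * (z * star z) ∂complexGaussian w = w * w + w * w := by
    have := integral_conj_mul_self_sq_complexGaussian w
    simp only [sq] at this
    simp_rw [mul_comm _ (star _)]
    rw [this]; ring
  have h2' (w : ℝ≥0) : ∫ z, z * star z ∂complexGaussian w = w := by
    simp_rw [mul_comm _ (star _)]
    exact integral_conj_mul_self_complexGaussian w
  have prod_pair (a b : ι) (hab : a ≠ b) (h : ∀ t, t ≠ a → t ≠ b →
      ∫ z, g t z ∂complexGaussian (v t) = 1) : ∏ t, ∫ z, g t z ∂complexGaussian (v t) =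
        (∫ z, g a z ∂complexGaussian (v a)) * ∫ z, g b z ∂complexGaussian (v b) := by
    refine Fintype.prod_eq_mul a b hab fun t ht => h t ht.1 ht.2
  rw [e2]
  by_cases hij : i = j
  · subst hij
    by_cases hkl : k = l
    · subst hkl
      by_cases hik : i = k
      · subst hik
        rw [Fintype.prod_eq_single i fun t ht => by simp [hg, ht]]
        simp only [hg, if_true, and_self]
        exact h4 _
      · rw [prod_pair i k hik fun t h1 h2 => by simp [hg, h1, h2]]
        simp only [hg, hik, Ne.symm hik, if_true, if_false, and_self, one_mul, mul_one, add_zero]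
        rw [integral_conj_mul_self_complexGaussian, h2']
    · have hik : ¬ (i = k ∧ i = l) := fun h => hkl (h.1.symm.trans h.2)
      rw [if_neg (by tauto), if_neg hik, add_zero]
      -- Without a pairing some variable occurs alone: `X l` if `k = i`, and `X k` otherwise. Its
      -- mean is zero.
      by_cases h : k = i
      · have hl : l ≠ i := fun h' => hkl (h.trans h'.symm)
        refine Finset.prod_eq_zero (Finset.mem_univ l) ?_
        simp only [hg, hl, Ne.symm hkl, if_false, if_true, one_mul]
        exact hstar _
      · refine Finset.prod_eq_zero (Finset.mem_univ k) ?_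
        simp only [hg, h, hkl, if_false, if_true, one_mul, mul_one]
        exact integral_id_complexGaussian _
  · by_cases hik : i = k
    · subst hik
      by_cases hjl : j = l
      · subst hjl
        rw [prod_pair i j hij fun t h1 h2 => by simp [hg, h1, h2]]
        simp only [hg, hij, Ne.symm hij, if_true, if_false, and_self, one_mul, mul_one,
          zero_add]
        rw [integral_conj_mul_self_complexGaussian, h2']
      · rw [if_neg (by tauto), if_neg (by tauto), add_zero]
        refine Finset.prod_eq_zero (Finset.mem_univ j) ?_
        simp only [hg, Ne.symm hij, hjl, if_false, if_true, one_mul, mul_one]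
        exact integral_id_complexGaussian _
    · rw [if_neg (by tauto), if_neg (by tauto), add_zero]
      refine Finset.prod_eq_zero (Finset.mem_univ i) ?_
      -- `X i` meets no unconjugated partner: its factor is `star z * star z` or a lone `star z`,
      -- and both integrate to zero.
      by_cases hil : i = l
      · subst hil
        simp only [hg, hij, hik, if_false, if_true, one_mul, mul_one]
        exact hstar2 _
      · simp only [hg, hij, hik, hil, if_false, if_true, mul_one]
        exact hstar _

theorem integral_wick_sum
    (hX : ∀ i, HasLaw (X i) (complexGaussian (v i)) μ) (hind : iIndepFun X μ) (a b c d : ι → ℂ) :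
    ∫ s, star (∑ i, a i * X i s) * (∑ i, b i * X i s) *
        ((∑ i, c i * X i s) * star (∑ i, d i * X i s)) ∂μ =
      weightedInner v b a * weightedInner v c d + weightedInner v c a * weightedInner v b d := by
  have e : ∀ s, star (∑ i, a i * X i s) * (∑ i, b i * X i s) *
        ((∑ i, c i * X i s) * star (∑ i, d i * X i s)) =
      ∑ i, ∑ j, ∑ k, ∑ l, star (a i) * b j * (c k * star (d l)) *
        (star (X i s) * X j s * (X k s * star (X l s))) := fun s => by
    rw [star_sum, star_sum, Finset.sum_mul_sum, Finset.sum_mul_sum, Finset.sum_mul]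
    refine Finset.sum_congr rfl fun i _ => ?_
    rw [Finset.sum_mul]
    refine Finset.sum_congr rfl fun j _ => ?_
    rw [Finset.mul_sum]
    refine Finset.sum_congr rfl fun k _ => ?_
    rw [Finset.mul_sum]
    refine Finset.sum_congr rfl fun l _ => ?_
    simp only [star_mul']
    ring
  have hm (i : ι) : MemLp (X i) 4 μ := memLp_of_hasLaw_complexGaussian (hX i) 4
  have hint (i j k l : ι) : Integrable (fun s => star (a i) * b j * (c k * star (d l)) *
        (star (X i s) * X j s * (X k s * star (X l s)))) μ :=
    (integrable_conj_mul_mul_mul_conj (hm i) (hm j) (hm k) (hm l)).const_mul _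
  simp_rw [e]
  rw [integral_finsetSum _ fun i _ => integrable_finsetSum _ fun j _ => integrable_finsetSum _
    fun k _ => integrable_finsetSum _ fun l _ => hint i j k l]
  have e3 : ∀ i, ∫ s, ∑ j, ∑ k, ∑ l, star (a i) * b j * (c k * star (d l)) *
        (star (X i s) * X j s * (X k s * star (X l s))) ∂μ =
      ∑ j, ∑ k, ∑ l, star (a i) * b j * (c k * star (d l)) *
        ((if i = j ∧ k = l then (v i : ℂ) * v k else 0) +
        (if i = k ∧ j = l then (v i : ℂ) * v j else 0)) := fun i => by
    rw [integral_finsetSum _ fun j _ => integrable_finsetSum _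
      fun k _ => integrable_finsetSum _ fun l _ => hint i j k l]
    refine Finset.sum_congr rfl fun j _ => ?_
    rw [integral_finsetSum _ fun k _ => integrable_finsetSum _ fun l _ => hint i j k l]
    refine Finset.sum_congr rfl fun k _ => ?_
    rw [integral_finsetSum _ fun l _ => hint i j k l]
    refine Finset.sum_congr rfl fun l _ => ?_
    rw [integral_const_mul, integral_wick_of_iIndepFun hX hind]
  simp_rw [e3, mul_add, Finset.sum_add_distrib]
  congr 1
  · rw [weightedInner, weightedInner, Finset.sum_mul_sum]
    refine Finset.sum_congr rfl fun i _ => ?_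
    -- This pairing forces `j = i` and `l = k`, so the free index `k` is moved outside `j`.
    rw [Finset.sum_comm]
    refine Finset.sum_congr rfl fun k _ => ?_
    rw [Finset.sum_eq_single i (fun j _ hj => by simp [Ne.symm hj]) (by simp),
      Finset.sum_eq_single k (fun l _ hl => by simp [Ne.symm hl]) (by simp)]
    simp only [and_self, if_true]
    ring
  · rw [weightedInner, weightedInner, Finset.sum_mul_sum]
    refine Finset.sum_congr rfl fun i _ => ?_
    refine Finset.sum_congr rfl fun j _ => ?_
    rw [Finset.sum_eq_single i (fun k _ hk => by simp [Ne.symm hk]) (by simp),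
      Finset.sum_eq_single j (fun l _ hl => by simp [Ne.symm hl]) (by simp)]
    simp only [and_self, if_true]
    ring

end Wick

/-! ### The Fejér kernel as a squared geometric sum. -/

section Fejer

theorem normSq_exp_neg_mul_I_sub_one (φ : ℝ) :
    Complex.normSq (Complex.exp (-(φ : ℂ) * Complex.I) - 1) = 2 * (1 - Real.cos φ) := by
  rw [← Complex.ofReal_neg, Complex.exp_mul_I, ← Complex.ofReal_cos, ← Complex.ofReal_sin]
  simp only [Complex.normSq_apply, Complex.sub_re, Complex.sub_im, Complex.add_re, Complex.add_im,
    Complex.mul_re, Complex.mul_im, Complex.ofReal_re, Complex.ofReal_im, Complex.I_re,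
    Complex.I_im, Complex.one_re, Complex.one_im, Real.cos_neg, Real.sin_neg]
  linear_combination Real.sin_sq_add_cos_sq φ

theorem normSq_geom_sum_exp (L : ℕ) {φ : ℝ} (hφ : Real.cos φ ≠ 1) :
    Complex.normSq ((L : ℂ)⁻¹ * ∑ l : Fin L, Complex.exp (-(φ : ℂ) * Complex.I) ^ (l : ℕ)) =
      scaledFejer L φ := by
  have h1 : Complex.normSq (Complex.exp (-(φ : ℂ) * Complex.I) - 1) ≠ 0 := by
    rw [normSq_exp_neg_mul_I_sub_one]
    exact mul_ne_zero two_ne_zero (sub_ne_zero.2 hφ.symm)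
  rw [Fin.sum_univ_eq_sum_range (fun l => Complex.exp (-(φ : ℂ) * Complex.I) ^ l),
    geom_sum_eq (fun h => h1 (by rw [h, sub_self, map_zero])), ← Complex.exp_nat_mul,
    show (L : ℂ) * (-(φ : ℂ) * Complex.I) = -((L * φ : ℝ) : ℂ) * Complex.I by push_cast; ring,
    Complex.normSq_mul, Complex.normSq_div, normSq_exp_neg_mul_I_sub_one,
    normSq_exp_neg_mul_I_sub_one, mul_div_mul_left _ _ two_ne_zero, scaledFejer]
  simp [sq, Complex.normSq_apply]

/-- Indices below `W` put the angle strictly between `-2π` and `2π`, where only zero has cosine 1.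
-/
theorem cos_subcarrier_ne_one {W : ℕ} {p ω : Fin W} (h : p ≠ ω) :
    Real.cos (2 * Real.pi / (W : ℝ) * (((p : ℕ) : ℝ) - ((ω : ℕ) : ℝ))) ≠ 1 := by
  have hW : (0 : ℝ) < W := Nat.cast_pos.2 (Fin.pos p)
  have hπ := Real.pi_pos
  have h1 : ((p : ℕ) : ℝ) < W := Nat.cast_lt.2 p.2
  have h2 : ((ω : ℕ) : ℝ) < W := Nat.cast_lt.2 ω.2
  have h3 : (0 : ℝ) ≤ (p : ℕ) := Nat.cast_nonneg _
  have h4 : (0 : ℝ) ≤ (ω : ℕ) := Nat.cast_nonneg _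
  have hc : 0 < 2 * Real.pi / (W : ℝ) := by positivity
  have e : 2 * Real.pi / (W : ℝ) * W = 2 * Real.pi := div_mul_cancel₀ _ hW.ne'
  rw [Ne, Real.cos_eq_one_iff_of_lt_of_lt (by nlinarith) (by nlinarith)]
  refine mul_ne_zero hc.ne' (sub_ne_zero.2 fun h' => h ?_)
  exact Fin.ext (Nat.cast_injective h')

end Fejer

/-! ### Covariances of the channel entries. -/

section Channel

variable {B U L W : ℕ}

/-- The square root is Hermitian. This eliminates it from all covariances, where only `R` remains.
-/
theorem corrMatrix_sqrt_mul_conj {δ : ℝ} (hR : (corrMatrix B δ).PosSemidef) (b b' : Fin B) :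
    ∑ c, CFC.sqrt (corrMatrix B δ) b c * star (CFC.sqrt (corrMatrix B δ) b' c) =
      corrMatrix B δ b b' := by
  have h1 : (CFC.sqrt (corrMatrix B δ))ᴴ = CFC.sqrt (corrMatrix B δ) :=
    (Matrix.nonneg_iff_posSemidef.1 (CFC.sqrt_nonneg (corrMatrix B δ))).isHermitian
  have h2 := CFC.sqrt_mul_sqrt_self (corrMatrix B δ) (Matrix.nonneg_iff_posSemidef.2 hR)
  conv_rhs => rw [← h2]
  rw [Matrix.mul_apply]
  refine Finset.sum_congr rfl fun c _ => ?_
  congr 1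
  rw [← Matrix.conjTranspose_apply, h1]

/-- The phase of the tap `l` on subcarrier `q`. -/
noncomputable def tapPhase (q : Fin W) (l : Fin L) : ℂ :=
  Complex.exp (-(Complex.I * 2 * Real.pi * ((q : ℕ) : ℂ) * ((l : ℕ) : ℂ) / (W : ℂ)))

/-- The coefficients of an entry of the channel matrix with respect to the independent complex
Gaussian variables that it is made of. -/
noncomputable def channelCoeff (L : ℕ) (δ σ : ℝ) (q : Fin W) (b : Fin B) (u : Fin U) :
    (Fin L × Fin B × Fin U) ⊕ (Fin W × Fin B × Fin U) → ℂ :=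
  Sum.elim (fun i => tapPhase q i.1 * if i.2.2 = u then CFC.sqrt (corrMatrix B δ) b i.2.1 else 0)
    (fun i => if i = (q, b, u) then (σ : ℂ) else 0)

/-- The variances of the independent entries of the taps and of the estimation errors. -/
noncomputable def entryVariance (B U L W : ℕ) :
    (Fin L × Fin B × Fin U) ⊕ (Fin W × Fin B × Fin U) → ℝ≥0 :=
  Sum.elim (fun _ => 1 / ((B : ℝ≥0) * (L : ℝ≥0))) (fun _ => 1)

/-- The correlation coefficient between two subcarriers. -/
noncomputable def freqCorr (L : ℕ) (q q' : Fin W) : ℂ :=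
  (L : ℂ)⁻¹ * ∑ l : Fin L, tapPhase q l * star (tapPhase q' l)

/-- The covariance of entries of a column of the channel matrix on subcarriers `q` and `q'`. -/
noncomputable def channelCov (L : ℕ) (δ σ : ℝ) (q q' : Fin W) (b b' : Fin B) : ℂ :=
  corrMatrix B δ b b' * ((B : ℂ)⁻¹ * freqCorr L q q') +
    if q = q' ∧ b = b' then (σ : ℂ) ^ 2 else 0

theorem freqChannel_apply_eq_sum (δ σ : ℝ) (H : Fin L → Matrix (Fin B) (Fin U) ℂ)
    (E : Fin W → Matrix (Fin B) (Fin U) ℂ) (q : Fin W) (b : Fin B) (u : Fin U) :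
    freqChannel δ σ H E q b u = ∑ i, channelCoeff L δ σ q b u i *
      Sum.elim (fun i : Fin L × Fin B × Fin U => H i.1 i.2.1 i.2.2)
        (fun i : Fin W × Fin B × Fin U => E i.1 i.2.1 i.2.2) i := by
  rw [Fintype.sum_sum_type, freqChannel, Matrix.add_apply, Matrix.sum_apply]
  congr 1
  · simp only [channelCoeff, Sum.elim_inl, Fintype.sum_prod_type, Matrix.smul_apply, correlatedTap,
      Matrix.mul_apply, smul_eq_mul]
    refine Finset.sum_congr rfl fun l _ => ?_
    rw [Finset.mul_sum]
    refine Finset.sum_congr rfl fun c _ => ?_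
    rw [Finset.sum_eq_single u (fun u' _ h => by simp [h]) (by simp)]
    simp [tapPhase, mul_assoc]
  · simp [channelCoeff]

/-- Distinct columns involve disjoint sets of variables. Within a column, the taps give `R` times
the phase correlation, and the errors contribute only on the same subcarrier and antenna. -/
theorem weightedInner_channelCoeff {δ : ℝ} (hR : (corrMatrix B δ).PosSemidef) (σ : ℝ)
    (q q' : Fin W) (b b' : Fin B) (u u' : Fin U) :
    weightedInner (entryVariance B U L W) (channelCoeff L δ σ q b u)
        (channelCoeff L δ σ q' b' u') = if u = u' then channelCov L δ σ q q' b b' else 0 := by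
  rw [weightedInner, Fintype.sum_sum_type]
  simp only [channelCoeff, entryVariance, Sum.elim_inl, Sum.elim_inr]
  have h1 : ∑ i : Fin L × Fin B × Fin U,
      (tapPhase q i.1 * if i.2.2 = u then CFC.sqrt (corrMatrix B δ) b i.2.1 else 0) *
        star (tapPhase q' i.1 * if i.2.2 = u' then CFC.sqrt (corrMatrix B δ) b' i.2.1 else 0) *
        ((1 / ((B : ℝ≥0) * (L : ℝ≥0)) : ℝ≥0) : ℂ) =
      if u = u' then corrMatrix B δ b b' * ((B : ℂ)⁻¹ * freqCorr L q q') else 0 := by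
    simp only [Fintype.sum_prod_type]
    by_cases h : u = u'
    · subst h
      rw [if_pos rfl, ← corrMatrix_sqrt_mul_conj hR, freqCorr, ← mul_assoc, ← mul_assoc,
        Finset.mul_sum]
      refine Finset.sum_congr rfl fun l _ => ?_
      rw [Finset.sum_mul, Finset.sum_mul, Finset.sum_mul]
      refine Finset.sum_congr rfl fun c _ => ?_
      rw [Finset.sum_eq_single u (fun u' _ h => by simp [h]) (by simp)]
      simp only [if_true, star_mul']
      push_cast
      rw [one_div, mul_inv]
      ring
    · rw [if_neg h]
      refine Finset.sum_eq_zero fun l _ => Finset.sum_eq_zero fun c _ =>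
        Finset.sum_eq_zero fun w _ => ?_
      by_cases hw : w = u
      · simp [hw, h]
      · simp [hw]
  have h2 : ∑ i : Fin W × Fin B × Fin U, (if i = (q, b, u) then (σ : ℂ) else 0) *
      star (if i = (q', b', u') then (σ : ℂ) else 0) * ((1 : ℝ≥0) : ℂ) =
      if u = u' then (if q = q' ∧ b = b' then (σ : ℂ) ^ 2 else 0) else 0 := by
    rw [Finset.sum_eq_single (q, b, u) (fun i _ h => by simp [h]) (by simp)]
    by_cases h : u = u' <;> by_cases h' : q = q' ∧ b = b'
    · simp [h, h', sq]
    · simp only [h, if_true, if_neg h', Prod.mk.injEq, and_true]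
      simp
    · simp [h]
    · simp [h]
  rw [h1, h2, channelCov]
  split_ifs <;> simp

theorem freqCorr_self (hL : 1 ≤ L) (q : Fin W) : freqCorr L q q = 1 := by
  have h (l : Fin L) : tapPhase q l * star (tapPhase q l) = 1 := by
    rw [Complex.star_def, tapPhase, ← Complex.exp_conj, ← Complex.exp_add, ← Complex.exp_zero]
    congr 1
    simp [Complex.conj_ofNat]
    ring
  have hL' : (L : ℂ) ≠ 0 := Nat.cast_ne_zero.2 (by omega)
  simp only [freqCorr, h, Finset.sum_const, Finset.card_univ, Fintype.card_fin, nsmul_eq_mul,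
    mul_one, inv_mul_cancel₀ hL']

theorem freqCorr_conj (q q' : Fin W) : freqCorr L q' q = star (freqCorr L q q') := by
  simp [freqCorr, mul_comm]

theorem freqCorr_mul_freqCorr {p ω : Fin W} (h : p ≠ ω) :
    freqCorr L p ω * freqCorr L ω p = (scaledFejer L
      (2 * Real.pi / (W : ℝ) * (((p : ℕ) : ℝ) - ((ω : ℕ) : ℝ))) : ℂ) := by
  rw [freqCorr_conj p ω, Complex.star_def, Complex.mul_conj,
    ← normSq_geom_sum_exp L (cos_subcarrier_ne_one h), freqCorr]
  -- The phase products are the powers of `exp(-jφ)`, with `φ` proportional to `p - ω`.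
  refine congrArg (fun z : ℂ => (Complex.normSq ((L : ℂ)⁻¹ * z) : ℂ)) ?_
  refine Finset.sum_congr rfl fun l _ => ?_
  rw [Complex.star_def, tapPhase, tapPhase, ← Complex.exp_conj, ← Complex.exp_add,
    ← Complex.exp_nat_mul]
  congr 1
  simp [Complex.conj_ofNat]
  ring

theorem sum_sq_corrMatrix (B : ℕ) (δ : ℝ) :
    ∑ b, ∑ b', corrMatrix B δ b b' ^ 2 = (B : ℂ) * (1 + epsCor B δ : ℝ) := by
  -- Split as `δ²` everywhere plus `1 - δ²` on the diagonal: the total is `B²δ² + B(1 - δ²)`.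
  have h (b b' : Fin B) : corrMatrix B δ b b' ^ 2 =
      (δ : ℂ) ^ 2 + if b = b' then 1 - (δ : ℂ) ^ 2 else 0 := by
    rw [corrMatrix, Matrix.of_apply]
    split_ifs <;> ring
  simp only [h, Finset.sum_add_distrib, Finset.sum_ite_eq, Finset.mem_univ, if_true,
    Finset.sum_const, Finset.card_univ, Fintype.card_fin, nsmul_eq_mul, epsCor]
  push_cast
  ring

theorem corrMatrix_symm (B : ℕ) (δ : ℝ) (b b' : Fin B) :
    corrMatrix B δ b b' = corrMatrix B δ b' b := by
  simp [corrMatrix, eq_comm]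

theorem sum_channelCov_mul_self (hB : 1 ≤ B) (hL : 1 ≤ L) (δ σ : ℝ) (q : Fin W) :
    ∑ b, ∑ b', channelCov L δ σ q q b' b * channelCov (B := B) L δ σ q q b b' =
      ((B : ℂ)⁻¹ * (1 + epsCor B δ : ℝ) + 2 * σ ^ 2 + B * σ ^ 4) := by
  have hB' : (B : ℂ) ≠ 0 := Nat.cast_ne_zero.2 (by omega)
  -- The covariance is `R/B + σ²I`; the cross term and `σ⁴` live on the diagonal, where `R` is 1.
  have h (b b' : Fin B) : channelCov L δ σ q q b' b * channelCov L δ σ q q b b' =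
      (B : ℂ)⁻¹ ^ 2 * corrMatrix B δ b b' ^ 2 +
        if b = b' then 2 * (B : ℂ)⁻¹ * σ ^ 2 + σ ^ 4 else 0 := by
    simp only [channelCov, freqCorr_self hL, true_and, mul_one, corrMatrix_symm B δ b' b]
    by_cases h : b = b'
    · simp only [h, if_true, corrMatrix, Matrix.of_apply]
      ring
    · simp only [h, Ne.symm h, if_false]
      ring
  simp only [h, Finset.sum_add_distrib, ← Finset.mul_sum, sum_sq_corrMatrix, Finset.sum_ite_eq,
    Finset.mem_univ, if_true, Finset.sum_const, Finset.card_univ, Fintype.card_fin, nsmul_eq_mul]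
  field_simp
  ring

theorem sum_channelCov_mul_of_ne (hB : 1 ≤ B) (δ σ : ℝ) {q q' : Fin W} (hq : q ≠ q') :
    ∑ b, ∑ b', channelCov L δ σ q' q b' b * channelCov (B := B) L δ σ q q' b b' =
      (B : ℂ)⁻¹ * (1 + epsCor B δ : ℝ) * (freqCorr L q q' * freqCorr L q' q) := by
  have hB' : (B : ℂ) ≠ 0 := Nat.cast_ne_zero.2 (by omega)
  have h (b b' : Fin B) : channelCov L δ σ q' q b' b * channelCov L δ σ q q' b b' =
      (B : ℂ)⁻¹ ^ 2 * (freqCorr L q q' * freqCorr L q' q) * corrMatrix B δ b b' ^ 2 := by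
    simp only [channelCov, hq, Ne.symm hq, false_and, if_false, corrMatrix_symm B δ b' b]
    ring
  simp only [h, ← Finset.mul_sum, sum_sq_corrMatrix]
  field_simp

/-- The power per entry is the same on every subcarrier, which makes the first Wick pairing cancel
from the error. -/
theorem sum_channelCov_diag (hL : 1 ≤ L) (δ σ : ℝ) (q q' : Fin W) :
    ∑ b, channelCov (B := B) L δ σ q q b b = ∑ b, channelCov (B := B) L δ σ q' q' b b := by
  simp [channelCov, freqCorr_self hL]

end Channel

/-! ### Second moments of Gram entries. -/

section Gram

theorem freqChannel_apply_eq_sum_entries {S : Type*} {B U L W : ℕ}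
    (H : Fin L → S → Matrix (Fin B) (Fin U) ℂ) (E : Fin W → S → Matrix (Fin B) (Fin U) ℂ)
    (δ σ : ℝ) (s : S) (q : Fin W) (b : Fin B) (u : Fin U) :
    freqChannel δ σ (fun l => H l s) (fun w => E w s) q b u = ∑ i, channelCoeff L δ σ q b u i *
      Sum.elim (fun (i : Fin L × Fin B × Fin U) (s : S) => H i.1 s i.2.1 i.2.2)
        (fun (i : Fin W × Fin B × Fin U) (s : S) => E i.1 s i.2.1 i.2.2) i s := by
  rw [freqChannel_apply_eq_sum]
  refine Finset.sum_congr rfl fun i _ => ?_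
  rcases i with i | i <;> rfl

variable {S : Type*} [MeasurableSpace S] {μ : Measure S} {B U L W : ℕ}
  {H : Fin L → S → Matrix (Fin B) (Fin U) ℂ} {E : Fin W → S → Matrix (Fin B) (Fin U) ℂ}

theorem hasLaw_entries
    (hH : ∀ l b u, HasLaw (fun s => H l s b u) (complexGaussian (1 / ((B : ℝ≥0) * (L : ℝ≥0)))) μ)
    (hE : ∀ w b u, HasLaw (fun s => E w s b u) (complexGaussian 1) μ)
    (i : (Fin L × Fin B × Fin U) ⊕ (Fin W × Fin B × Fin U)) :
    HasLaw (Sum.elim (fun (i : Fin L × Fin B × Fin U) (s : S) => H i.1 s i.2.1 i.2.2)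
        (fun (i : Fin W × Fin B × Fin U) (s : S) => E i.1 s i.2.1 i.2.2) i)
      (complexGaussian (entryVariance B U L W i)) μ := by
  rcases i with ⟨l, b, u⟩ | ⟨w, b, u⟩
  · exact hH l b u
  · exact hE w b u

theorem gramMatrix_mul_star_gramMatrix (δ σ : ℝ) (H : Fin L → Matrix (Fin B) (Fin U) ℂ)
    (E : Fin W → Matrix (Fin B) (Fin U) ℂ) (q q' : Fin W) (m n : Fin U) :
    gramMatrix δ σ H E q m n * star (gramMatrix δ σ H E q' m n) =
      ∑ b, ∑ b', star (freqChannel δ σ H E q b m) * freqChannel δ σ H E q b n *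
        (freqChannel δ σ H E q' b' m * star (freqChannel δ σ H E q' b' n)) := by
  simp only [gramMatrix, Matrix.mul_apply, Matrix.conjTranspose_apply, star_sum, star_mul',
    star_star, Finset.sum_mul_sum]

theorem integrable_freqChannel_wick
    (hH : ∀ l b u, HasLaw (fun s => H l s b u) (complexGaussian (1 / ((B : ℝ≥0) * (L : ℝ≥0)))) μ)
    (hE : ∀ w b u, HasLaw (fun s => E w s b u) (complexGaussian 1) μ)
    (δ σ : ℝ) (q q' : Fin W) (m n : Fin U) (b b' : Fin B) :
    Integrable (fun s => star (freqChannel δ σ (fun l => H l s) (fun w => E w s) q b m) *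
      freqChannel δ σ (fun l => H l s) (fun w => E w s) q b n *
        (freqChannel δ σ (fun l => H l s) (fun w => E w s) q' b' m *
          star (freqChannel δ σ (fun l => H l s) (fun w => E w s) q' b' n))) μ := by
  simp only [freqChannel_apply_eq_sum_entries]
  have h := memLp_sum_of_hasLaw_complexGaussian (hasLaw_entries hH hE)
  exact integrable_conj_mul_mul_mul_conj (h _) (h _) (h _) (h _)

theorem integrable_gramMatrix_mul_star_gramMatrix
    (hH : ∀ l b u, HasLaw (fun s => H l s b u) (complexGaussian (1 / ((B : ℝ≥0) * (L : ℝ≥0)))) μ)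
    (hE : ∀ w b u, HasLaw (fun s => E w s b u) (complexGaussian 1) μ)
    (δ σ : ℝ) (q q' : Fin W) (m n : Fin U) :
    Integrable (fun s => gramMatrix δ σ (fun l => H l s) (fun w => E w s) q m n *
      star (gramMatrix δ σ (fun l => H l s) (fun w => E w s) q' m n)) μ := by
  simp only [gramMatrix_mul_star_gramMatrix]
  exact integrable_finsetSum _ fun b _ => integrable_finsetSum _ fun b' _ =>
    integrable_freqChannel_wick hH hE δ σ q q' m n b b'

theorem integral_gramMatrix_mul_star_gramMatrix
    (hH : ∀ l b u, HasLaw (fun s => H l s b u) (complexGaussian (1 / ((B : ℝ≥0) * (L : ℝ≥0)))) μ)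
    (hE : ∀ w b u, HasLaw (fun s => E w s b u) (complexGaussian 1) μ)
    (hind : iIndepFun
      (Sum.elim (fun (i : Fin L × Fin B × Fin U) (s : S) => H i.1 s i.2.1 i.2.2)
        (fun (i : Fin W × Fin B × Fin U) (s : S) => E i.1 s i.2.1 i.2.2)) μ)
    {δ : ℝ} (hR : (corrMatrix B δ).PosSemidef) (σ : ℝ) (q q' : Fin W) (m n : Fin U) :
    ∫ s, gramMatrix δ σ (fun l => H l s) (fun w => E w s) q m n *
      star (gramMatrix δ σ (fun l => H l s) (fun w => E w s) q' m n) ∂μ =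
      (if m = n then (∑ b, channelCov (B := B) L δ σ q q b b) *
        ∑ b, channelCov (B := B) L δ σ q' q' b b else 0) +
      ∑ b, ∑ b', channelCov L δ σ q' q b' b * channelCov (B := B) L δ σ q q' b b' := by
  simp only [gramMatrix_mul_star_gramMatrix]
  have hi := integrable_freqChannel_wick hH hE δ σ q q' m n
  rw [integral_finsetSum _ fun b _ => integrable_finsetSum _ fun b' _ => hi b b']
  simp_rw [integral_finsetSum _ fun b' _ => hi _ b', freqChannel_apply_eq_sum_entries,
    integral_wick_sum (hasLaw_entries hH hE) hind, weightedInner_channelCoeff hR, if_true,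
    Finset.sum_add_distrib]
  congr 1
  -- The first pairing factors into separate sums over `b` and `b'`; the second always pairs equal
  -- columns and needs no case split.
  rw [← Finset.sum_mul_sum]
  by_cases h : m = n
  · simp [h]
  · simp [h, Ne.symm h]

end Gram

/-! ### The mean-squared error. -/

theorem theorem1 {S : Type*} [MeasurableSpace S] (μ : Measure S) [IsProbabilityMeasure μ]
    (B U L W : ℕ) (hB : 1 ≤ B) (hL : 1 ≤ L) (hLW : L ≤ W)
    (δ σ : ℝ) (hδ : δ ^ 2 ≤ 1) (hR : (corrMatrix B δ).PosSemidef) (hσ : 0 ≤ σ)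
    (H : Fin L → S → Matrix (Fin B) (Fin U) ℂ)
    (E : Fin W → S → Matrix (Fin B) (Fin U) ℂ)
    (hH : ∀ l b u, HasLaw (fun s => H l s b u) (complexGaussian (1 / ((B : ℝ≥0) * (L : ℝ≥0)))) μ)
    (hE : ∀ w b u, HasLaw (fun s => E w s b u) (complexGaussian 1) μ)
    (hind : iIndepFun
      (Sum.elim (fun (i : Fin L × Fin B × Fin U) (s : S) => H i.1 s i.2.1 i.2.2)
        (fun (i : Fin W × Fin B × Fin U) (s : S) => E i.1 s i.2.1 i.2.2)) μ)
    (active P : Finset (Fin W)) (hP : P ⊆ active) (nearest : Fin W → Fin W)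
    (hnearest : ∀ ω ∈ active \ P, IsNearestBasePoint P ω (nearest ω))
    (ω : Fin W) (hω : ω ∈ active \ P) (m n : Fin U) :
    Integrable (fun s =>
        zeroOrderSqError δ σ P nearest (fun l => H l s) (fun w => E w s) ω m n) μ ∧
      ∫ s, zeroOrderSqError δ σ P nearest (fun l => H l s) (fun w => E w s) ω m n ∂μ =
        epsCSI B σ + 2 / (B : ℝ) * (1 + epsCor B δ) *
          (1 - scaledFejer L
            (2 * Real.pi / (W : ℝ) * (((nearest ω : ℕ) : ℝ) - ((ω : ℕ) : ℝ)))) := by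
  have hωP : ω ∉ P := (Finset.mem_sdiff.1 hω).2
  -- Distinctness removes the noise from the cross covariance and keeps the Fejér denominator
  -- nonzero.
  have hne : nearest ω ≠ ω := fun h => hωP (h ▸ (hnearest ω hω).1)
  set p := nearest ω with hp
  set G : Fin W → S → ℂ := fun q s => gramMatrix δ σ (fun l => H l s) (fun w => E w s) q m n
    with hG
  have hint (q q' : Fin W) : Integrable (fun s => G q s * star (G q' s)) μ :=
    integrable_gramMatrix_mul_star_gramMatrix hH hE δ σ q q' m n
  have hval (q q' : Fin W) := integral_gramMatrix_mul_star_gramMatrix hH hE hind hR σ q q' m n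
  have e : ∀ s, ((zeroOrderSqError δ σ P nearest (fun l => H l s) (fun w => E w s) ω m n : ℝ) : ℂ) =
      (G p s * star (G p s) - G p s * star (G ω s)) -
        (G ω s * star (G p s) - G ω s * star (G ω s)) := fun s => by
    rw [zeroOrderSqError, zeroOrderInterp, if_neg hωP, ← Complex.normSq_eq_norm_sq,
      ← Complex.mul_conj, map_sub]
    simp only [hG, hp, Complex.star_def]
    ring
  have hi1 := (hint p p).sub (hint p ω)
  have hi2 := (hint ω p).sub (hint ω ω)
  have hC : Integrable (fun s => ((zeroOrderSqError δ σ P nearest (fun l => H l s)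
      (fun w => E w s) ω m n : ℝ) : ℂ)) μ := by
    simp_rw [e]
    exact hi1.sub hi2
  refine ⟨by simpa using hC.re, ?_⟩
  have hB' : (B : ℂ) ≠ 0 := Nat.cast_ne_zero.2 (by omega)
  rw [← Complex.ofReal_inj]
  refine (integral_ofReal (𝕜 := ℂ)).symm.trans ?_
  refine (integral_congr_ae (Filter.Eventually.of_forall e)).trans ?_
  refine (integral_sub hi1 hi2).trans ?_
  simp only [Pi.sub_apply]
  rw [integral_sub (hint p p) (hint p ω), integral_sub (hint ω p) (hint ω ω)]
  simp only [hG, hval]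
  -- With both traces written at `ω`, the four `m = n` terms are identical and cancel in `ring`.
  rw [sum_channelCov_diag (B := B) hL δ σ p ω, sum_channelCov_mul_self hB hL,
    sum_channelCov_mul_self hB hL, sum_channelCov_mul_of_ne hB δ σ hne,
    sum_channelCov_mul_of_ne hB δ σ hne.symm, mul_comm (freqCorr L ω p),
    freqCorr_mul_freqCorr hne, epsCSI]
  push_cast
  field_simp
  ring
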